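/- Consider the push protocol on the complete graph with $n \ge 1$ nodes: initially exactly one node is informed, and in each round $t = 1, 2, \dots$ every informed node calls a node chosen uniformly at random from all $n$ nodes (itself included), all choices being independent; the called node becomes informed. Informed nodes remain informed. Let $T_n$ be the rumor spreading time, that is, the smallest $t \ge 0$ such that all $n$ nodes are informed at the end of round $t$. Then \[ \mathbb{E}[T_n] = \log_2 n + \ln n \pm O(1), \] that is, there is an absolute constant $K$ such that for every $n \ge 1$ the expectation $\mathbb{E}[T_n]$ is finite and $\left| \mathbb{E}[T_n] - (\log_2 n + \ln n) \right| \le K$. -/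

import Mathlib

open MeasureTheory ProbabilityTheory
open scoped ENNReal

/-- The set of informed nodes of the push protocol on the node set `Fin n` at the end of round `t`,
when `v₀` is informed initially and node `v` calls node `calls t v` in round `t + 1`. In each round
every informed node informs the node it calls; informed nodes stay informed. Calls of uninformed
nodes have no effect. -/
def pushInformed {n : ℕ} (calls : ℕ → Fin n → Fin n) (v₀ : Fin n) : ℕ → Finset (Fin n)
  | 0 => {v₀}
  | t + 1 => pushInformed calls v₀ t ∪ (pushInformed calls v₀ t).image (calls t)

/-- The rumor spreading time: the first `t` such that all nodes are informed at the end of round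
`t` (and `⊤` if there is no such `t`). -/
noncomputable def pushSpreadingTime {n : ℕ} (calls : ℕ → Fin n → Fin n) (v₀ : Fin n) : ℕ∞ :=
  ⨅ (t : ℕ) (_ : pushInformed calls v₀ t = Finset.univ), (t : ℕ∞)

/-- Random calls in the complete graph on `n` nodes: all calls, over all rounds and all nodes,
are independent, and each is uniformly distributed on all `n` nodes (the caller included). -/
structure IsUniformCalls {Ω : Type*} [MeasurableSpace Ω] (μ : Measure Ω) {n : ℕ}
    (C : ℕ → Fin n → Ω → Fin n) : Prop where
  measurable : ∀ t v, Measurable (C t v)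
  uniform : ∀ t v w, μ {ω | C t v ω = w} = (n : ℝ≥0∞)⁻¹
  indep : iIndepFun (fun p : ℕ × Fin n => C p.1 p.2) μ

/-- The expected rumor spreading time of the push protocol started in node `v₀`, as an
extended nonnegative real number. -/
noncomputable def expectedPushTime {Ω : Type*} [MeasurableSpace Ω] (μ : Measure Ω) {n : ℕ}
    (C : ℕ → Fin n → Ω → Fin n) (v₀ : Fin n) : ℝ≥0∞ :=
  ∫⁻ ω, (pushSpreadingTime (fun t v => C t v ω) v₀ : ℝ≥0∞) ∂μ

/-! With k informed and u = n - k uninformed nodes, put x = k/n and y = u/n. An uninformed node is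
missed in one round with probability p = (1 - 1/n)^k ≈ e^{-x}, so ln(1 + u) drops by about x.
Meanwhile k grows by a factor of about 1 + y, so log₂ k grows by about y. Both approximations hold
up to O(xy). As x + y = 1, the potential ln(1 + u) - log₂ k loses about 1 per round in every phase.
It starts at ln n (k = 1) and ends at -log₂ n (k = n), whence the main term.

The error in one round is at most 4xy + 16(1 - p)/√(1 + u) + 4y/k; the last two terms absorb the
random fluctuations. `errorPotential` is bounded and decreases in expectation by at least this
error, so the errors add up to O(1). Adding it to `mainPotential` gives a loss of at least 1 per
round, subtracting it a loss of at most 1. `drift_bounds` contains this analysis;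
`integral_potential_le` sums the drift and so bounds ∑ P(T > t) = E[T] from both sides. -/

open scoped BigOperators

/-! ### Mean and variance of the uninformed count after one round -/

/-- The probability that the calls of the nodes in `S` all avoid `W`. -/
lemma expect_disjoint_image {n : ℕ} (hn : 0 < n) (S W : Finset (Fin n)) :
    𝔼 c : Fin n → Fin n, (if Disjoint (S.image c) W then (1 : ℝ) else 0) =
      (1 - (W.card : ℝ) / n) ^ S.card := by
  have hcount : (Finset.univ.filter fun c : Fin n → Fin n => Disjoint (S.image c) W) =
      Fintype.piFinset fun s => if s ∈ S then Wᶜ else Finset.univ := by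
    ext c
    simp only [Finset.mem_filter, Finset.mem_univ, true_and, Fintype.mem_piFinset,
      Finset.disjoint_left, Finset.mem_image, forall_exists_index, and_imp,
      forall_apply_eq_imp_iff₂]
    refine forall_congr' fun s => ?_
    by_cases hs : s ∈ S <;> simp [hs]
  have hn' : (n : ℝ) ≠ 0 := by positivity
  have hW : W.card ≤ n := by simpa using Finset.card_le_univ W
  have hS : S.card ≤ n := by simpa using Finset.card_le_univ S
  rw [Fintype.expect_eq_sum_div_card, Finset.sum_boole, hcount, Fintype.card_piFinset]
  have hprod : ∏ s, (if s ∈ S then Wᶜ else (Finset.univ : Finset (Fin n))).card =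
      (n - W.card) ^ S.card * n ^ (n - S.card) := by
    simp only [apply_ite Finset.card, Finset.card_compl, Finset.card_univ, Fintype.card_fin]
    rw [Finset.prod_ite]
    simp [Finset.filter_not, Finset.card_univ_sdiff]
  rw [hprod]
  push_cast [Nat.cast_sub hW, Fintype.card_fun, Fintype.card_fin]
  have h2 : (n : ℝ) ^ n = (n : ℝ) ^ S.card * (n : ℝ) ^ (n - S.card) := by
    rw [← pow_add, Nat.add_sub_cancel' hS]
  rw [h2, mul_div_mul_right _ _ (by positivity), ← div_pow, sub_div, div_self hn']

/-- The nodes informed after one round, if the nodes in `S` were informed before. -/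
abbrev pushStep {n : ℕ} (S : Finset (Fin n)) (c : Fin n → Fin n) : Finset (Fin n) :=
  S ∪ S.image c

lemma card_compl_pushStep {n : ℕ} (S : Finset (Fin n)) (c : Fin n → Fin n) :
    ((n : ℝ) - (pushStep S c).card) = ∑ v ∈ Sᶜ, if Disjoint (S.image c) {v} then (1 : ℝ) else 0 := by
  rw [Finset.sum_boole, ← Nat.cast_sub (by simpa using Finset.card_le_univ (pushStep S c))]
  congr 1
  have := Finset.card_compl (pushStep S c)
  rw [Fintype.card_fin] at this
  rw [← this]
  congr 1
  ext v
  simp [pushStep]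

lemma expect_card_compl_pushStep {n : ℕ} (hn : 0 < n) (S : Finset (Fin n)) :
    𝔼 c : Fin n → Fin n, ((n : ℝ) - (pushStep S c).card) =
      (n - S.card) * (1 - 1 / n : ℝ) ^ S.card := by
  have hS : S.card ≤ n := by simpa using Finset.card_le_univ S
  simp only [card_compl_pushStep]
  rw [Finset.expect_sum_comm]
  simp only [expect_disjoint_image hn]
  simp [Finset.card_compl, Nat.cast_sub hS]

/-- Being missed is negatively correlated for two distinct nodes, since (1 - 2/n)^k ≤ (1 -
1/n)^(2k). Thus the second moment is at most that of independent indicators. The condition n ≥ 2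
keeps 1 - 2/n nonnegative. -/
lemma expect_sq_card_compl_pushStep {n : ℕ} (hn : 2 ≤ n) (S : Finset (Fin n)) :
    𝔼 c : Fin n → Fin n, ((n : ℝ) - (pushStep S c).card) ^ 2 ≤
      ((n : ℝ) - S.card) * (1 - 1 / n : ℝ) ^ S.card +
        (n - S.card) * (n - S.card - 1) * ((1 - 1 / n : ℝ) ^ S.card) ^ 2 := by
  have hn0 : 0 < n := by omega
  have hS : S.card ≤ n := by simpa using Finset.card_le_univ S
  have hmul : ∀ (c : Fin n → Fin n) v w, (if Disjoint (S.image c) {v} then (1 : ℝ) else 0) *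
      (if Disjoint (S.image c) {w} then (1 : ℝ) else 0) =
      if Disjoint (S.image c) {v, w} then (1 : ℝ) else 0 := by
    intro c v w
    simp only [Finset.insert_eq, Finset.disjoint_union_right]
    by_cases h1 : Disjoint (S.image c) {v} <;> by_cases h2 : Disjoint (S.image c) {w} <;>
      simp only [h1, h2, and_true, and_false, if_true, if_false, mul_one, mul_zero]
  simp only [card_compl_pushStep, sq, Finset.sum_mul_sum, hmul]
  rw [Finset.expect_sum_comm]
  simp_rw [Finset.expect_sum_comm, expect_disjoint_image hn0]
  set p : ℝ := (1 - 1 / n : ℝ) ^ S.card with hp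
  have hq : (1 - 2 / n : ℝ) ^ S.card ≤ p * p := by
    rw [hp, ← mul_pow]
    have : (2 : ℝ) ≤ n := by exact_mod_cast hn
    apply pow_le_pow_left₀
    · rw [sub_nonneg, div_le_one (by linarith)]; exact this
    · have : (0 : ℝ) ≤ 1 / n * (1 / n) := by positivity
      have e : (2 / n : ℝ) = 2 * (1 / n) := by ring
      rw [e]; nlinarith
  have hinner : ∀ v ∈ Sᶜ, ∑ w ∈ Sᶜ, (1 - (({v, w} : Finset (Fin n)).card : ℝ) / n) ^ S.card ≤
      p + (n - S.card - 1) * (p * p) := by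
    intro v hv
    rw [← Finset.add_sum_erase _ _ hv]
    have hcard : (((Sᶜ).erase v).card : ℝ) = n - S.card - 1 := by
      have h1 : 1 ≤ (Sᶜ).card := Finset.card_pos.2 ⟨v, hv⟩
      rw [Finset.card_erase_of_mem hv, Nat.cast_sub h1, Finset.card_compl, Fintype.card_fin,
        Nat.cast_sub hS]
      simp
    rw [← hcard, ← nsmul_eq_mul]
    refine add_le_add ?_ (Finset.sum_le_card_nsmul _ _ _ ?_)
    · simp [hp]
    · intro w hw
      rw [Finset.card_pair (Finset.ne_of_mem_erase hw).symm]
      exact_mod_cast hq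
  refine (Finset.sum_le_card_nsmul _ _ _ hinner).trans ?_
  rw [nsmul_eq_mul, Finset.card_compl, Fintype.card_fin, Nat.cast_sub hS]
  exact le_of_eq (by ring)

/-- The variance of the number of uninformed nodes after one round. -/
lemma variance_card_compl_pushStep_le {n : ℕ} (hn : 2 ≤ n) (S : Finset (Fin n)) :
    𝔼 c : Fin n → Fin n,
      ((n : ℝ) - (pushStep S c).card - (n - S.card) * (1 - 1 / n : ℝ) ^ S.card) ^ 2 ≤
      (n - S.card) * (1 - 1 / n : ℝ) ^ S.card * (1 - (1 - 1 / n : ℝ) ^ S.card) := by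
  have hn0 : 0 < n := by omega
  have : NeZero n := ⟨hn0.ne'⟩
  have h1 := expect_card_compl_pushStep hn0 S
  have h2 := expect_sq_card_compl_pushStep hn S
  set p : ℝ := (1 - 1 / n : ℝ) ^ S.card with hp
  set μ : ℝ := (n - S.card) * p
  have : ∀ c : Fin n → Fin n, ((n : ℝ) - (pushStep S c).card - μ) ^ 2 =
      ((n : ℝ) - (pushStep S c).card) ^ 2 + (-2 * μ) * ((n : ℝ) - (pushStep S c).card) + μ ^ 2 := by
    intro c; ring
  simp only [this]
  rw [Finset.expect_add_distrib, Finset.expect_add_distrib, ← Finset.mul_expect,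
    Fintype.expect_const, h1]
  have : μ ^ 2 = (n - S.card) ^ 2 * p ^ 2 := by ring
  nlinarith

/-! ### Elementary inequalities -/

lemma sub_one_sub_two_mul_sq_le_log {z : ℝ} (hz : 1 / 2 ≤ z) :
    (z - 1) - 2 * (z - 1) ^ 2 ≤ Real.log z := by
  have hz0 : 0 < z := by linarith
  refine le_trans ?_ (Real.one_sub_inv_le_log_of_pos hz0)
  have h1 : 1 - z⁻¹ - ((z - 1) - 2 * (z - 1) ^ 2) = (z - 1) ^ 2 * (2 * z - 1) / z := by
    field_simp
    ring
  have h2 : 0 ≤ (z - 1) ^ 2 * (2 * z - 1) / z :=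
    div_nonneg (mul_nonneg (sq_nonneg _) (by linarith)) hz0.le
  linarith

/-- A quadratic lower bound of the logarithm on `[1 / a, ∞)`. -/
lemma sub_one_sub_mul_sq_le_log {a z : ℝ} (ha : 1 ≤ a) (hz : 1 / a ≤ z) :
    (z - 1) - (2 + 4 * Real.log a) * (z - 1) ^ 2 ≤ Real.log z := by
  have hla := Real.log_nonneg ha
  rcases le_total (1 / 2) z with h | h
  · have := sub_one_sub_two_mul_sq_le_log h
    nlinarith [mul_nonneg hla (sq_nonneg (z - 1))]
  · have h1 : Real.log (1 / a) ≤ Real.log z := Real.log_le_log (by positivity) hz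
    rw [one_div, Real.log_inv] at h1
    -- Away from 1 the quadratic term alone is at least ln a, which is why its coefficient contains
    -- 4 ln a.
    have h2 : 1 / 4 ≤ (z - 1) ^ 2 := by nlinarith
    nlinarith [mul_le_mul_of_nonneg_left h2 hla, sq_nonneg (z - 1)]

/-- `log₂ (1 + y) ≥ y` on `[0, 1]`. -/
lemma le_logb_two_one_add {y : ℝ} (h0 : 0 ≤ y) (h1 : y ≤ 1) : y ≤ Real.logb 2 (1 + y) := by
  rw [Real.le_logb_iff_rpow_le (by norm_num) (by linarith)]
  have := rpow_one_add_le_one_add_mul_self (s := 1) (by norm_num) h0 h1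
  norm_num at this
  linarith

lemma half_lt_log_two : (1 / 2 : ℝ) < Real.log 2 := by
  have := Real.log_two_gt_d9
  linarith

/-- The functions log₂(1 + y) and y agree at both endpoints, so the error can carry the factor y(1 -
y), which becomes xy in the application. -/
lemma logb_two_one_add_le {y : ℝ} (h0 : 0 ≤ y) (h1 : y ≤ 1) :
    Real.logb 2 (1 + y) ≤ y + 2 * (1 - y) * y := by
  rcases le_total y (1 / 2) with h | h
  · have hl := Real.log_le_sub_one_of_pos (show 0 < 1 + y by linarith)
    have h2 := half_lt_log_two
    have : Real.logb 2 (1 + y) ≤ 2 * y := by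
      rw [Real.logb, div_le_iff₀ (by linarith)]
      nlinarith
    nlinarith
  · have : Real.logb 2 (1 + y) ≤ 1 := by
      rw [Real.logb_le_iff_le_rpow (by norm_num) (by linarith)]
      norm_num; linarith
    nlinarith

lemma log_le_two_mul_sqrt {a : ℝ} (ha : 0 < a) : Real.log a ≤ 2 * (√a - 1) := by
  have h := Real.log_le_sub_one_of_pos (Real.sqrt_pos.2 ha)
  rw [Real.log_sqrt ha.le] at h
  linarith

/-- The tangent line of the convex function `1 / √t`. -/
lemma tangent_le_inv_sqrt {b t : ℝ} (hb : 0 < b) (ht : 0 < t) :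
    1 / √b - (t - b) / (2 * b * √b) ≤ 1 / √t := by
  obtain ⟨s, hs, rfl⟩ : ∃ s, 0 < s ∧ s ^ 2 = t := ⟨√t, Real.sqrt_pos.2 ht, Real.sq_sqrt ht.le⟩
  obtain ⟨r, hr, rfl⟩ : ∃ s, 0 < s ∧ s ^ 2 = b := ⟨√b, Real.sqrt_pos.2 hb, Real.sq_sqrt hb.le⟩
  rw [Real.sqrt_sq hs.le, Real.sqrt_sq hr.le]
  have : 1 / s - (1 / r - (s ^ 2 - r ^ 2) / (2 * r ^ 2 * r)) =
      (s - r) ^ 2 * (s + 2 * r) / (2 * r ^ 3 * s) := by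
    field_simp
    ring
  have : 0 ≤ (s - r) ^ 2 * (s + 2 * r) / (2 * r ^ 3 * s) := by positivity
  linarith

/-- The chord of the convex function `1 / t` on `[k, 2 k]`. -/
lemma inv_le_chord {k t : ℝ} (hk : 0 < k) (h1 : k ≤ t) (h2 : t ≤ 2 * k) :
    1 / t ≤ 1 / k - (t - k) / (2 * k ^ 2) := by
  have ht : 0 < t := by linarith
  have : 1 / k - (t - k) / (2 * k ^ 2) - 1 / t = (t - k) * (2 * k - t) / (2 * k ^ 2 * t) := by
    field_simp
    ring
  have : 0 ≤ (t - k) * (2 * k - t) / (2 * k ^ 2 * t) :=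
    div_nonneg (mul_nonneg (by linarith) (by linarith)) (by positivity)
  linarith

/-- The linear term averages to zero. With γ = 0 this is Jensen's inequality through a tangent or
chord; with γ > 0 the variance pays for the curvature. -/
lemma expect_le_of_le_quadratic {ι : Type*} [Fintype ι] [Nonempty ι] {f X : ι → ℝ}
    {α β γ μ V : ℝ} (hγ : 0 ≤ γ) (hμ : 𝔼 i, X i = μ) (hV : 𝔼 i, (X i - μ) ^ 2 ≤ V)
    (hf : ∀ i, f i ≤ α + β * (X i - μ) + γ * (X i - μ) ^ 2) : 𝔼 i, f i ≤ α + γ * V := by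
  calc 𝔼 i, f i ≤ 𝔼 i, (α + β * (X i - μ) + γ * (X i - μ) ^ 2) :=
        Finset.expect_le_expect fun i _ => hf i
    _ = α + γ * 𝔼 i, (X i - μ) ^ 2 := by
        rw [Finset.expect_add_distrib, Finset.expect_add_distrib, ← Finset.mul_expect,
          ← Finset.mul_expect, Finset.expect_sub_distrib, hμ, Fintype.expect_const,
          Fintype.expect_const]
        ring
    _ ≤ α + γ * V := by gcongr

/-- Bounds on the probability `(1 - 1 / n) ^ k` that `k` calls avoid a given node. -/
lemma avoid_prob_bounds {n k : ℕ} (hk : 1 ≤ k) (hkn : k < n) :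
    let p : ℝ := (1 - 1 / n) ^ k
    1 / 4 ≤ p ∧ Real.log p ≤ -(k / n) ∧ -(k / n) - 2 * (k / n) * ((n - k) / n) ≤ Real.log p ∧
      k / n * ((n - k) / n) ≤ 1 - p ∧ k / n / 2 ≤ 1 - p ∧ 1 - p ≤ k / n := by
  intro p
  have hn2 : (2 : ℝ) ≤ n := by exact_mod_cast (show 2 ≤ n by omega)
  have hkn' : (k : ℝ) + 1 ≤ n := by exact_mod_cast hkn
  have hk1 : (1 : ℝ) ≤ k := by exact_mod_cast hk
  have hq : (0 : ℝ) < 1 - 1 / n := by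
    rw [sub_pos, div_lt_one (by linarith)]; linarith
  have hp : 0 < p := pow_pos hq k
  have hlog : Real.log p = k * Real.log (1 - 1 / n) := Real.log_pow _ _
  have h1 : Real.log p ≤ -(k / n) := by
    rw [hlog]
    have := mul_le_mul_of_nonneg_left (Real.log_le_sub_one_of_pos hq) (show (0 : ℝ) ≤ k by linarith)
    refine this.trans (le_of_eq ?_)
    ring
  have h2 : -(k / (n - 1) : ℝ) ≤ Real.log p := by
    rw [hlog]
    have := mul_le_mul_of_nonneg_left (Real.one_sub_inv_le_log_of_pos hq)
      (show (0 : ℝ) ≤ k by linarith)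
    refine le_trans (le_of_eq ?_) this
    have : (n : ℝ) - 1 ≠ 0 := by linarith
    have : (n : ℝ) ≠ 0 := by linarith
    have e : (1 : ℝ) - 1 / n = (n - 1) / n := by field_simp
    rw [e]
    field_simp
    ring
  have hexp : 1 / 4 ≤ p := by
    have h3 : (k / (n - 1) : ℝ) ≤ 1 := by
      rw [div_le_one (by linarith)]; linarith
    have h4 : Real.exp (-1) ≤ p := by
      rw [← Real.le_log_iff_exp_le hp]; linarith
    refine le_trans ?_ h4
    rw [Real.exp_neg, one_div]
    apply inv_anti₀ (Real.exp_pos _)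
    have := Real.exp_one_lt_d9
    linarith
  have hx : (0 : ℝ) ≤ k / n := by positivity
  have hx1 : (k / n : ℝ) ≤ 1 := by rw [div_le_one (by linarith)]; linarith
  -- From p ≤ e^{-x} ≤ 1/(1 + x) follows 1 - p ≥ x/(1 + x), which dominates both x(1 - x) and x/2.
  have h9 : p * (1 + k / n) ≤ 1 := by
    have h7 : p ≤ (Real.exp (k / n))⁻¹ := by
      rw [← Real.exp_neg, ← Real.log_le_iff_le_exp hp]; exact h1
    have h8 := Real.add_one_le_exp (k / n : ℝ)
    calc p * (1 + k / n) ≤ (Real.exp (k / n))⁻¹ * Real.exp (k / n) := by gcongr; linarith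
      _ = 1 := inv_mul_cancel₀ (Real.exp_pos _).ne'
  refine ⟨hexp, h1, ?_, ?_, ?_, ?_⟩
  · refine le_trans ?_ h2
    -- The numerator is nonnegative because n - k ≥ 1 and n ≥ 2.
    have h5 : -(k / (n - 1) : ℝ) - (-(k / n) - 2 * (k / n) * ((n - k) / n)) =
        k * (2 * (n - k) * (n - 1) - n) / (n ^ 2 * (n - 1)) := by
      have : (n : ℝ) - 1 ≠ 0 := by linarith
      have : (n : ℝ) ≠ 0 := by linarith
      field_simp
      ring
    have h6 : 0 ≤ k * (2 * (n - k) * (n - 1) - n : ℝ) / (n ^ 2 * (n - 1)) := by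
      apply div_nonneg
      · apply mul_nonneg (by linarith)
        nlinarith
      · apply mul_nonneg (by positivity) (by linarith)
    linarith
  · rw [show ((n - k) / n : ℝ) = 1 - k / n by rw [sub_div, div_self (by linarith)]]
    nlinarith [mul_nonneg (mul_nonneg hx hx) hx]
  · nlinarith [mul_nonneg hx hx]
  · have := one_add_mul_le_pow (show (-2 : ℝ) ≤ -(1 / n) by
      have : (1 / n : ℝ) ≤ 1 := by rw [div_le_one (by linarith)]; linarith
      linarith) k
    have e : (1 : ℝ) + k * -(1 / n) = 1 - k / n := by ring
    rw [e, ← sub_eq_add_neg] at this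
    linarith

/-! ### One-round expectations of the terms of the potentials -/

section
variable {ι : Type*} [Fintype ι] [Nonempty ι] {U : ι → ℝ} {u p : ℝ}

/-- Jensen's inequality, followed by comparing 1 + up with p(1 + u), which is smaller by 1 - p. -/
lemma expect_log_one_add_le (hu : 0 ≤ u) (hp : 1 / 4 ≤ p) (hp1 : p ≤ 1) (hU : ∀ i, 0 ≤ U i)
    (hμ : 𝔼 i, U i = u * p) :
    𝔼 i, Real.log (1 + U i) ≤ Real.log (1 + u) + Real.log p + 4 * ((1 - p) / √(1 + u)) := by
  have hp0 : 0 < p := by linarith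
  have ha : 0 < 1 + u * p := by positivity
  have h1 : 𝔼 i, Real.log (1 + U i) ≤ Real.log (1 + u * p) + 0 * 𝔼 i, (U i - u * p) ^ 2 := by
    refine expect_le_of_le_quadratic (X := U) (β := 1 / (1 + u * p)) le_rfl hμ le_rfl fun i => ?_
    have := Real.log_le_sub_one_of_pos (show 0 < (1 + U i) / (1 + u * p) by have := hU i; positivity)
    rw [Real.log_div (by have := hU i; positivity) ha.ne'] at this
    have e : (1 + U i) / (1 + u * p) - 1 = 1 / (1 + u * p) * (U i - u * p) := by
      field_simp
      ring
    linarith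
  have hb : 0 < p * (1 + u) := by positivity
  have h2 := Real.log_le_sub_one_of_pos (div_pos ha hb)
  rw [Real.log_div ha.ne' hb.ne', Real.log_mul hp0.ne' (by positivity)] at h2
  have e : (1 + u * p) / (p * (1 + u)) - 1 = (1 - p) / (p * (1 + u)) := by
    field_simp
    ring
  have h3 : (1 - p) / (p * (1 + u)) ≤ 4 * ((1 - p) / √(1 + u)) := by
    have h4 : √(1 + u) / 4 ≤ p * (1 + u) := by
      have h5 : √(1 + u) ≤ 1 + u := Real.sqrt_le_self_iff.2 (by simp [hu])
      nlinarith
    calc (1 - p) / (p * (1 + u)) ≤ (1 - p) / (√(1 + u) / 4) := by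
          apply div_le_div_of_nonneg_left (by linarith) (by positivity) h4
      _ = _ := by field_simp
  linarith

/-- The quadratic minorant of the logarithm is used at (1 + U)/a ≥ 1/a, where a = 1 + up is the mean
of 1 + U. Its coefficient 2 + 4 ln a is at most 8√a and the variance at most a(1 - p), so the loss
is O((1 - p)/√a). -/
lemma le_expect_log_one_add (hu : 0 ≤ u) (hp : 1 / 4 ≤ p) (hp1 : p ≤ 1) (hU : ∀ i, 0 ≤ U i)
    (hμ : 𝔼 i, U i = u * p) (hV : 𝔼 i, (U i - u * p) ^ 2 ≤ u * p * (1 - p)) :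
    Real.log (1 + u) + Real.log p - 16 * ((1 - p) / √(1 + u)) ≤ 𝔼 i, Real.log (1 + U i) := by
  have hp0 : 0 < p := by linarith
  obtain ⟨a, ha⟩ : ∃ a, a = 1 + u * p := ⟨_, rfl⟩
  have ha1 : 1 ≤ a := by rw [ha]; nlinarith
  have ha0 : 0 < a := by linarith
  have hla := Real.log_nonneg ha1
  have h1 : 𝔼 i, -Real.log (1 + U i) ≤ -Real.log a +
      (2 + 4 * Real.log a) / a ^ 2 * (u * p * (1 - p)) := by
    refine expect_le_of_le_quadratic (X := U) (β := -1 / a) (by positivity) hμ hV fun i => ?_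
    have hi := hU i
    have := sub_one_sub_mul_sq_le_log (z := (1 + U i) / a) ha1 (by gcongr; linarith)
    rw [Real.log_div (by positivity) ha0.ne'] at this
    have e : (1 + U i) / a - 1 = 1 / a * (U i - u * p) := by
      field_simp
      rw [ha]; ring
    rw [e] at this
    have e2 : (2 + 4 * Real.log a) * (1 / a * (U i - u * p)) ^ 2 =
      (2 + 4 * Real.log a) / a ^ 2 * (U i - u * p) ^ 2 := by ring
    have e3 : 1 / a * (U i - u * p) = - (-1 / a * (U i - u * p)) := by ring
    rw [e2, e3] at this
    linarith
  rw [Finset.expect_neg_distrib] at h1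
  have h2 : Real.log (1 + u) + Real.log p ≤ Real.log a := by
    rw [← Real.log_mul (by positivity) hp0.ne']
    apply Real.log_le_log (by positivity)
    rw [ha]; nlinarith
  -- Here p ≥ 1/4 gives 1 + u ≤ 4a.
  have hs : √(1 + u) ≤ 2 * √a := by
    rw [show (2 : ℝ) = √4 by rw [show (4 : ℝ) = 2 ^ 2 by norm_num]; simp, ← Real.sqrt_mul (by norm_num)]
    apply Real.sqrt_le_sqrt
    rw [ha]; nlinarith
  have hsa : 0 < √a := Real.sqrt_pos.2 ha0
  have hsq : √a * √a = a := Real.mul_self_sqrt ha0.le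
  have h3 : (2 + 4 * Real.log a) / a ^ 2 * (u * p * (1 - p)) ≤ 16 * ((1 - p) / √(1 + u)) := by
    calc (2 + 4 * Real.log a) / a ^ 2 * (u * p * (1 - p))
        ≤ (8 * √a) / a ^ 2 * (a * (1 - p)) := by
          have := log_le_two_mul_sqrt ha0
          gcongr
          · nlinarith
          · linarith
      _ = 16 * ((1 - p) / (2 * √a)) := by
          rw [show a ^ 2 = a * (√a * √a) by rw [hsq]; ring]
          field_simp
          ring
      _ ≤ 16 * ((1 - p) / √(1 + u)) := by
          gcongr
  linarith
end

section
variable {ι : Type*} [Fintype ι] [Nonempty ι] {U : ι → ℝ} {u k p : ℝ}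

lemma expect_logb_le (hu : 0 ≤ u) (hk : 0 < k) (hp1 : p ≤ 1) (hpx : 1 - p ≤ k / (k + u))
    (hU : ∀ i, U i ≤ u) (hμ : 𝔼 i, U i = u * p) :
    𝔼 i, Real.logb 2 (k + u - U i) ≤
      Real.logb 2 k + u / (k + u) + 2 * (k / (k + u) * (u / (k + u))) := by
  have hl2 : 0 < Real.log 2 := Real.log_pos (by norm_num)
  have hm : 0 < k + u * (1 - p) := by
    have := mul_nonneg hu (sub_nonneg.2 hp1)
    linarith
  have h1 : 𝔼 i, Real.logb 2 (k + u - U i) ≤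
      Real.logb 2 (k + u * (1 - p)) + 0 * 𝔼 i, (U i - u * p) ^ 2 := by
    refine expect_le_of_le_quadratic (X := U) (β := -1 / ((k + u * (1 - p)) * Real.log 2))
      le_rfl hμ le_rfl fun i => ?_
    have hi : 0 < k + u - U i := by linarith [hU i]
    have := Real.log_le_sub_one_of_pos (div_pos hi hm)
    rw [Real.log_div hi.ne' hm.ne'] at this
    have h2 := div_le_div_of_nonneg_right this hl2.le
    rw [sub_div, ← Real.logb, ← Real.logb] at h2
    have e : ((k + u - U i) / (k + u * (1 - p)) - 1) / Real.log 2 =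
        -1 / ((k + u * (1 - p)) * Real.log 2) * (U i - u * p) := by
      field_simp
      ring
    linarith
  have hx : k / (k + u) = 1 - u / (k + u) := by field_simp; ring
  have hy0 : 0 ≤ u / (k + u) := by positivity
  have hy1 : u / (k + u) ≤ 1 := by rw [div_le_one (by linarith)]; linarith
  have h2 : Real.logb 2 (k + u * (1 - p)) ≤ Real.logb 2 k + Real.logb 2 (1 + u / (k + u)) := by
    rw [← Real.logb_mul (by positivity) (by positivity)]
    apply Real.logb_le_logb_of_le (by norm_num) hm
    have : u * (1 - p) ≤ u * (k / (k + u)) := by gcongr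
    have e : k * (1 + u / (k + u)) = k + u * (k / (k + u)) := by ring
    linarith
  have h3 := logb_two_one_add_le hy0 hy1
  rw [← hx] at h3
  linarith

/-- The informed count at most doubles, so its mean m is at most 2k and the ratio to m is at least
1/2. The quadratic minorant of the logarithm with constant 2 then applies. -/
lemma expect_neg_logb_le (hu : 0 ≤ u) (hk : 0 < k) (hp0 : 0 ≤ p) (hp1 : p ≤ 1)
    (hpx : 1 - p ≤ k / (k + u)) (hpx' : k / (k + u) * (u / (k + u)) ≤ 1 - p)
    (hU : ∀ i, U i ≤ u) (hU' : ∀ i, u - k ≤ U i) (hμ : 𝔼 i, U i = u * p)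
    (hV : 𝔼 i, (U i - u * p) ^ 2 ≤ u * p * (1 - p)) :
    𝔼 i, -Real.logb 2 (k + u - U i) ≤
      -Real.logb 2 k - u / (k + u) + 2 * (k / (k + u) * (u / (k + u))) +
        4 * (u / (k + u) / k) := by
  have hl2 : 0 < Real.log 2 := Real.log_pos (by norm_num)
  have hl2' := half_lt_log_two
  have hup : 0 ≤ u * (1 - p) := mul_nonneg hu (sub_nonneg.2 hp1)
  obtain ⟨m, hm⟩ : ∃ m, m = k + u * (1 - p) := ⟨_, rfl⟩
  have hm0 : 0 < m := by linarith
  have hkm : k ≤ m := by linarith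
  have hm2 : m ≤ 2 * k := by
    have h1 : u * p ≥ u - k := by
      rw [← hμ, ← Fintype.expect_const (ι := ι) (u - k)]
      exact Finset.expect_le_expect fun i _ => hU' i
    rw [hm]; linarith
  have h1 : 𝔼 i, -Real.logb 2 (k + u - U i) ≤
      -Real.logb 2 m + 2 / m ^ 2 / Real.log 2 * (u * p * (1 - p)) := by
    refine expect_le_of_le_quadratic (X := U) (β := 1 / (m * Real.log 2))
      (by positivity) hμ hV fun i => ?_
    have hi : 0 < k + u - U i := by linarith [hU i]
    have := sub_one_sub_two_mul_sq_le_log (z := (k + u - U i) / m) (by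
      rw [le_div_iff₀ hm0]; linarith [hU i])
    rw [Real.log_div hi.ne' hm0.ne'] at this
    have h2 := div_le_div_of_nonneg_right this hl2.le
    rw [sub_div _ (2 * _) (Real.log 2), sub_div (Real.log _) _ (Real.log 2), ← Real.logb, ← Real.logb] at h2
    have e0 : (k + u - U i) / m - 1 = -(U i - u * p) / m := by
      field_simp
      rw [hm]; ring
    rw [e0] at h2
    have e : -(U i - u * p) / m / Real.log 2 = - (1 / (m * Real.log 2) * (U i - u * p)) := by
      field_simp
    have e' : 2 * (-(U i - u * p) / m) ^ 2 / Real.log 2 =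
        2 / m ^ 2 / Real.log 2 * (U i - u * p) ^ 2 := by
      field_simp
    rw [e, e'] at h2
    linarith
  have hx : k / (k + u) = 1 - u / (k + u) := by field_simp; ring
  have hy0 : 0 ≤ u / (k + u) := by positivity
  have hy1 : u / (k + u) ≤ 1 := by rw [div_le_one (by linarith)]; linarith
  have h2 : Real.logb 2 k + u / (k + u) - 2 * (k / (k + u) * (u / (k + u))) ≤
      Real.logb 2 m := by
    have h3 := le_logb_two_one_add hy0 hy1
    have hy : 0 < k * (1 + u / (k + u)) := by positivity
    have h4 := Real.log_le_sub_one_of_pos (div_pos hy hm0)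
    -- Since m ≥ k + uxy and ux = ky, the excess of k(1 + y) over m is at most kxy ≤ mxy.
    have h5 : k * (1 + u / (k + u)) / m - 1 ≤ k / (k + u) * (u / (k + u)) := by
      rw [sub_le_iff_le_add, div_le_iff₀ hm0]
      have h6 : u * (k / (k + u) * (u / (k + u))) ≤ u * (1 - p) := by gcongr
      have e : k * (1 + u / (k + u)) - u * (k / (k + u) * (u / (k + u))) =
          k + k * (k / (k + u) * (u / (k + u))) := by
        field_simp
        ring
      have h7 : 0 ≤ k / (k + u) * (u / (k + u)) := by positivity
      have h8 := mul_le_mul_of_nonneg_right hkm h7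
      nlinarith
    have h6 : Real.logb 2 (k * (1 + u / (k + u))) - Real.logb 2 m ≤
        2 * (k / (k + u) * (u / (k + u))) := by
      rw [← Real.logb_div hy.ne' hm0.ne', Real.logb, div_le_iff₀ hl2]
      have : 0 ≤ k / (k + u) * (u / (k + u)) := by positivity
      nlinarith
    rw [Real.logb_mul hk.ne' (by positivity)] at h6
    linarith
  have h3 : 2 / m ^ 2 / Real.log 2 * (u * p * (1 - p)) ≤ 4 * (u / (k + u) / k) := by
    calc 2 / m ^ 2 / Real.log 2 * (u * p * (1 - p))
        ≤ 2 / k ^ 2 / (1 / 2) * (u * 1 * (k / (k + u))) := by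
          have : 0 ≤ 1 - p := sub_nonneg.2 hp1
          gcongr
      _ = 4 * (u / (k + u) / k) := by
          field_simp
          ring
  linarith

/-- Convexity of 1/√t gives the drift; u ≥ 1 turns u/(2(1 + u)) into the constant 1/4. -/
lemma expect_neg_inv_sqrt_le (hu : 1 ≤ u) (hp1 : p ≤ 1) (hU : ∀ i, 0 ≤ U i)
    (hμ : 𝔼 i, U i = u * p) :
    𝔼 i, -(1 / √(1 + U i)) ≤ -(1 / √(1 + u)) - (1 - p) / √(1 + u) / 4 := by
  have hs : 0 < √(1 + u) := Real.sqrt_pos.2 (by linarith)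
  have h1 : 𝔼 i, -(1 / √(1 + U i)) ≤
      -(1 / √(1 + u)) - u * (1 - p) / (2 * (1 + u) * √(1 + u)) + 0 * 𝔼 i, (U i - u * p) ^ 2 := by
    refine expect_le_of_le_quadratic (X := U) (β := 1 / (2 * (1 + u) * √(1 + u)))
      le_rfl hμ le_rfl fun i => ?_
    have := tangent_le_inv_sqrt (b := 1 + u) (t := 1 + U i) (by linarith) (by linarith [hU i])
    have e : (1 + U i - (1 + u)) / (2 * (1 + u) * √(1 + u)) =
      1 / (2 * (1 + u) * √(1 + u)) * (U i - u * p) - u * (1 - p) / (2 * (1 + u) * √(1 + u)) := by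
      ring
    linarith
  have h2 : (1 - p) / √(1 + u) / 4 ≤ u * (1 - p) / (2 * (1 + u) * √(1 + u)) := by
    have e : u * (1 - p) / (2 * (1 + u) * √(1 + u)) =
        (1 - p) / √(1 + u) * (u / (2 * (1 + u))) := by
      field_simp
    rw [e, div_eq_mul_one_div _ (4 : ℝ)]
    apply mul_le_mul_of_nonneg_left
    · rw [div_le_div_iff₀ (by norm_num) (by linarith)]; linarith
    · exact div_nonneg (by linarith) hs.le
  linarith

/-- Since the informed count stays in [k, 2k], the chord bounds 1/t from above by a linear function,
so only the mean matters. -/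
lemma expect_inv_le (hu : 0 ≤ u) (hk : 0 < k) (hpx : k / (k + u) / 2 ≤ 1 - p)
    (hU : ∀ i, U i ≤ u) (hU' : ∀ i, u - k ≤ U i) (hμ : 𝔼 i, U i = u * p) :
    𝔼 i, 1 / (k + u - U i) ≤ 1 / k - u / (k + u) / k / 4 := by
  have h1 : 𝔼 i, 1 / (k + u - U i) ≤
      1 / k - u * (1 - p) / (2 * k ^ 2) + 0 * 𝔼 i, (U i - u * p) ^ 2 := by
    refine expect_le_of_le_quadratic (X := U) (β := 1 / (2 * k ^ 2))
      le_rfl hμ le_rfl fun i => ?_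
    have := inv_le_chord (t := k + u - U i) hk (by linarith [hU i]) (by linarith [hU' i])
    refine this.trans (le_of_eq ?_)
    ring
  have h2 : u / (k + u) / k / 4 ≤ u * (1 - p) / (2 * k ^ 2) := by
    calc u / (k + u) / k / 4 = u * (k / (k + u) / 2) / (2 * k ^ 2) := by
          field_simp
          ring
      _ ≤ _ := by gcongr
  linarith
end

/-! ### The potentials and their drift -/

/-- The leading term of the expected remaining time with `k` of `n` nodes informed. -/
noncomputable def mainPotential (n k : ℝ) : ℝ := Real.log (1 + (n - k)) - Real.logb 2 k

/-- A bounded potential whose drift dominates the error of `mainPotential`. -/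
noncomputable def errorPotential (n k : ℝ) : ℝ :=
  8 * ((n - k) / n) - 64 * (1 / √(1 + (n - k))) + 16 * (1 / k)

/-- A bound on the one-round error of `mainPotential`. -/
noncomputable def potentialError (n k p : ℝ) : ℝ :=
  4 * (k / n * ((n - k) / n)) + 16 * ((1 - p) / √(1 + (n - k))) + 4 * ((n - k) / n / k)

section
variable {ι : Type*} [Fintype ι] [Nonempty ι] {K : ι → ℝ} {n k : ℕ}

lemma drift_bounds (hk : 1 ≤ k) (hkn : k < n) (hK : ∀ i, (k : ℝ) ≤ K i) (hK' : ∀ i, K i ≤ 2 * k)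
    (hKn : ∀ i, K i ≤ n) (hμ : 𝔼 i, (n - K i) = (n - k) * (1 - 1 / n : ℝ) ^ k)
    (hV : 𝔼 i, (n - K i - (n - k) * (1 - 1 / n : ℝ) ^ k) ^ 2 ≤
      (n - k) * (1 - 1 / n : ℝ) ^ k * (1 - (1 - 1 / n : ℝ) ^ k)) :
    (𝔼 i, mainPotential n (K i) ≤
      mainPotential n k - 1 + potentialError n k ((1 - 1 / n : ℝ) ^ k)) ∧
    (mainPotential n k - 1 - potentialError n k ((1 - 1 / n : ℝ) ^ k) ≤
      𝔼 i, mainPotential n (K i)) ∧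
    𝔼 i, errorPotential n (K i) ≤
      errorPotential n k - potentialError n k ((1 - 1 / n : ℝ) ^ k) := by
  obtain ⟨hp4, hl1, hl2, hp1, hp2, hp3⟩ := avoid_prob_bounds hk hkn
  have hk0 : (0 : ℝ) < k := by exact_mod_cast hk
  have hu1 : (1 : ℝ) ≤ n - k := by
    have : (k : ℝ) + 1 ≤ n := by exact_mod_cast hkn
    linarith
  generalize (1 - 1 / n : ℝ) ^ k = p at *
  obtain ⟨U, hU⟩ : ∃ U : ι → ℝ, ∀ i, U i = n - K i := ⟨_, fun _ => rfl⟩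
  obtain ⟨u, hu⟩ : ∃ u : ℝ, u = n - k := ⟨_, rfl⟩
  have hn : (n : ℝ) = k + u := by linarith
  simp only [← hU, ← hu] at hμ hV hp1 hp2 hp3 hu1 hl1 hl2
  rw [hn] at hp1 hp2 hp3 hl1 hl2
  have hKU : ∀ i, K i = k + u - U i := fun i => by rw [hU]; linarith
  have hxy : (k / (k + u) : ℝ) + u / (k + u) = 1 := by
    rw [← add_div, div_self]; linarith
  have hx0 : (0 : ℝ) < k / (k + u) := by apply div_pos <;> linarith
  have hy0 : (0 : ℝ) < u / (k + u) := by apply div_pos <;> linarith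
  have hxy0 := mul_pos hx0 hy0
  have hple : p ≤ 1 := by linarith
  have hU0 : ∀ i, 0 ≤ U i := fun i => by rw [hU]; linarith [hKn i]
  have hUu : ∀ i, U i ≤ u := fun i => by rw [hU]; linarith [hK i]
  have hUk : ∀ i, u - k ≤ U i := fun i => by rw [hU]; linarith [hK' i]
  have hu0 : 0 ≤ u := by linarith
  have hE1 : 0 ≤ (1 - p) / √(1 + u) := div_nonneg (by linarith) (Real.sqrt_nonneg _)
  have hE2 : 0 ≤ u / (k + u) / k := by positivity
  have hF : 𝔼 i, mainPotential n (K i) =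
      𝔼 i, Real.log (1 + U i) - 𝔼 i, Real.logb 2 (k + u - U i) := by
    rw [← Finset.expect_sub_distrib]
    simp only [mainPotential, hKU, hn, sub_sub_cancel]
  have b1 := expect_log_one_add_le hu0 hp4 hple hU0 hμ
  have b2 := le_expect_log_one_add hu0 hp4 hple hU0 hμ hV
  have b3 := expect_logb_le hu0 hk0 hple hp3 hUu hμ
  have b4 := expect_neg_logb_le hu0 hk0 (by linarith) hple hp3 hp1 hUu hUk hμ hV
  rw [Finset.expect_neg_distrib] at b4
  have b5 := expect_neg_inv_sqrt_le hu1 hple hU0 hμ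
  have b6 := expect_inv_le hu0 hk0 hp2 hUu hUk hμ
  rw [hF]
  refine ⟨?_, ?_, ?_⟩
  · simp only [mainPotential, potentialError, hn, add_sub_cancel_left]
    linarith
  · simp only [mainPotential, potentialError, hn, add_sub_cancel_left]
    linarith
  · have hH : 𝔼 i, errorPotential n (K i) = 8 / (k + u) * (u * p) +
        64 * 𝔼 i, -(1 / √(1 + U i)) + 16 * 𝔼 i, 1 / (k + u - U i) := by
      rw [← hμ, Finset.mul_expect, Finset.mul_expect, Finset.mul_expect,
        ← Finset.expect_add_distrib, ← Finset.expect_add_distrib]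
      refine Finset.expect_congr rfl fun i _ => ?_
      simp only [errorPotential, hKU, hn, sub_sub_cancel]
      ring
    rw [hH]
    simp only [errorPotential, potentialError, hn, add_sub_cancel_left]
    -- The weights 8, 64 and 16 of `errorPotential` are matched to the three error terms: here 1 - p
    -- ≥ x/2 yields the drop 4xy, and the factors 1/4 in `b5` and `b6` yield the other two.
    have h1 : 8 / (k + u) * (u * p) ≤ 8 * (u / (k + u)) - 4 * (k / (k + u) * (u / (k + u))) := by
      have := mul_le_mul_of_nonneg_left hp2 hy0.le
      have e : 8 / (k + u) * (u * p) = 8 * (u / (k + u)) - 8 * (u / (k + u) * (1 - p)) := by ring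
      linarith
    linarith
end

/-! ### Pathwise properties of the process -/

lemma pushInformed_succ {n : ℕ} (calls : ℕ → Fin n → Fin n) (v₀ : Fin n) (t : ℕ) :
    pushInformed calls v₀ (t + 1) = pushStep (pushInformed calls v₀ t) (calls t) := rfl

lemma pushInformed_congr {n : ℕ} {calls calls' : ℕ → Fin n → Fin n} (v₀ : Fin n) {t : ℕ}
    (h : ∀ s < t, calls s = calls' s) : pushInformed calls v₀ t = pushInformed calls' v₀ t := by
  induction t with
  | zero => rfl
  | succ t ih =>
    rw [pushInformed_succ, pushInformed_succ, ih fun s hs => h s (by omega), h t (by omega)]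

lemma mem_pushInformed {n : ℕ} (calls : ℕ → Fin n → Fin n) (v₀ : Fin n) (t : ℕ) :
    v₀ ∈ pushInformed calls v₀ t := by
  induction t with
  | zero => exact Finset.mem_singleton_self v₀
  | succ t ih => exact Finset.mem_union_left _ ih

lemma pushInformed_mono {n : ℕ} (calls : ℕ → Fin n → Fin n) (v₀ : Fin n) :
    Monotone (pushInformed calls v₀) :=
  monotone_nat_of_le_succ fun _ => Finset.subset_union_left

/-- Layer-cake formula: by monotonicity the rounds t with an uninformed node are exactly those below
T. It also holds when T is infinite. -/
lemma pushSpreadingTime_eq_tsum {n : ℕ} (calls : ℕ → Fin n → Fin n) (v₀ : Fin n) :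
    (pushSpreadingTime calls v₀ : ℝ≥0∞) =
      ∑' t, if pushInformed calls v₀ t ≠ Finset.univ then (1 : ℝ≥0∞) else 0 := by
  classical
  by_cases h : ∃ t, pushInformed calls v₀ t = Finset.univ
  · have hiff : ∀ t, pushInformed calls v₀ t ≠ Finset.univ ↔ t ∈ Finset.range (Nat.find h) := by
      intro t
      rw [Finset.mem_range, Nat.lt_find_iff]
      refine ⟨fun ht s hs hsu => ht ?_, fun ht => ht t le_rfl⟩
      exact Finset.univ_subset_iff.1 (hsu ▸ pushInformed_mono calls v₀ hs)
    have hT : pushSpreadingTime calls v₀ = (Nat.find h : ℕ∞) := by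
      refine le_antisymm (iInf₂_le (Nat.find h) (Nat.find_spec h)) (le_iInf₂ fun t ht => ?_)
      exact_mod_cast Nat.find_min' h ht
    rw [hT, tsum_eq_sum (s := Finset.range (Nat.find h))]
    · rw [Finset.sum_congr rfl fun t ht => if_pos ((hiff t).2 ht)]
      simp
    · intro t ht
      rw [if_neg fun h' => ht ((hiff t).1 h')]
  · push Not at h
    have hT : pushSpreadingTime calls v₀ = ⊤ :=
      iInf₂_eq_top.2 fun t ht => absurd ht (h t)
    rw [hT]
    simp [h]

/-! ### Independence of rounds and summation of drift -/

namespace IsUniformCalls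

variable {Ω : Type*} [MeasurableSpace Ω] {μ : Measure Ω} {n : ℕ} {C : ℕ → Fin n → Ω → Fin n}

lemma measurable_pushInformed (hC : IsUniformCalls μ C) (v₀ : Fin n) (t : ℕ) :
    @Measurable _ _ _ ⊤ fun ω => pushInformed (fun t v => C t v ω) v₀ t := by
  let _ : MeasurableSpace (Finset (Fin n)) := ⊤
  induction t with
  | zero => exact measurable_const
  | succ t ih =>
    have hY : Measurable fun ω v => C t v ω := measurable_pi_lambda _ (hC.measurable t)
    exact (Measurable.of_discrete
      (f := fun q : Finset (Fin n) × (Fin n → Fin n) => pushStep q.1 q.2)).comp (ih.prodMk hY)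

/-- The nodes informed at the end of round `t` are independent of the calls of round `t + 1`. -/
lemma indepFun_pushInformed (hC : IsUniformCalls μ C) (v₀ : Fin n) (t : ℕ) :
    @IndepFun _ _ _ _ ⊤ _ (fun ω => pushInformed (fun t v => C t v ω) v₀ t)
      (fun ω v => C t v ω) μ := by
  let _ : MeasurableSpace (Finset (Fin n)) := ⊤
  have hd : Disjoint (Finset.range t ×ˢ (Finset.univ : Finset (Fin n)))
      ({t} ×ˢ (Finset.univ : Finset (Fin n))) := by
    rw [Finset.disjoint_product]
    simp
  have h := hC.indep.indepFun_finset _ _ hd fun p => hC.measurable p.1 p.2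
  -- The default `v₀` is harmless: the state after round t depends only on the calls with index
  -- below t.
  let φ : (↥(Finset.range t ×ˢ (Finset.univ : Finset (Fin n))) → Fin n) → Finset (Fin n) :=
    fun a => pushInformed (fun s v => if hs : (s, v) ∈ Finset.range t ×ˢ Finset.univ then
      a ⟨(s, v), hs⟩ else v₀) v₀ t
  let ψ : (↥({t} ×ˢ (Finset.univ : Finset (Fin n))) → Fin n) → Fin n → Fin n :=
    fun a v => a ⟨(t, v), by simp⟩
  have h2 := h.comp (φ := φ) (ψ := ψ) .of_discrete .of_discrete
  have hφ : (fun ω => pushInformed (fun t v => C t v ω) v₀ t) = φ ∘ fun ω p => C p.1.1 p.1.2 ω := by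
    funext ω
    refine pushInformed_congr v₀ fun s hs => ?_
    funext v
    simp [hs]
  rw [hφ]
  exact h2

lemma integral_calls [IsProbabilityMeasure μ] (hC : IsUniformCalls μ C) (t : ℕ) (g : (Fin n → Fin n) → ℝ) :
    ∫ c, g c ∂(μ.map fun ω v => C t v ω) = 𝔼 c, g c := by
  have hY : Measurable fun ω v => C t v ω := measurable_pi_lambda _ (hC.measurable t)
  have := Measure.isProbabilityMeasure_map (μ := μ) hY.aemeasurable
  have hind : iIndepFun (fun v => C t v) μ :=
    hC.indep.precomp (g := fun v : Fin n => (t, v)) fun v w h => (Prod.mk.inj h).2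
  have hmap := (iIndepFun_iff_map_fun_eq_pi_map fun v => (hC.measurable t v).aemeasurable).1 hind
  have hsing : ∀ c : Fin n → Fin n, (μ.map fun ω v => C t v ω).real {c} = ((n : ℝ) ^ n)⁻¹ := by
    intro c
    have (v : Fin n) : IsProbabilityMeasure (μ.map (C t v)) :=
      Measure.isProbabilityMeasure_map (hC.measurable t v).aemeasurable
    have hv (v : Fin n) : μ.map (C t v) {c v} = (n : ℝ≥0∞)⁻¹ := by
      rw [Measure.map_apply (hC.measurable t v) (measurableSet_singleton _)]
      exact hC.uniform t v (c v)
    rw [Measure.real, hmap, Measure.pi_singleton]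
    simp [hv]
  rw [integral_fintype .of_finite]
  simp only [hsing, smul_eq_mul]
  rw [← Finset.mul_sum, Fintype.expect_eq_sum_div_card]
  simp [div_eq_inv_mul]

lemma integrable_pushInformed [IsProbabilityMeasure μ] (hC : IsUniformCalls μ C) (v₀ : Fin n) (t : ℕ)
    (f : Finset (Fin n) → ℝ) :
    Integrable (fun ω => f (pushInformed (fun t v => C t v ω) v₀ t)) μ := by
  let _ : MeasurableSpace (Finset (Fin n)) := ⊤
  have hX := hC.measurable_pushInformed v₀ t
  have := Measure.isProbabilityMeasure_map (μ := μ) hX.aemeasurable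
  exact (Integrable.of_finite (f := f)).comp_measurable hX

/-- The Markov property in integrated form: independence makes the joint law a product, and Fubini
averages over the fresh calls first. -/
lemma integral_pushInformed_succ [IsProbabilityMeasure μ] (hC : IsUniformCalls μ C) (v₀ : Fin n) (t : ℕ)
    (f : Finset (Fin n) → ℝ) :
    ∫ ω, f (pushInformed (fun t v => C t v ω) v₀ (t + 1)) ∂μ =
      ∫ ω, (𝔼 c, f (pushStep (pushInformed (fun t v => C t v ω) v₀ t) c)) ∂μ := by
  let _ : MeasurableSpace (Finset (Fin n)) := ⊤
  have hX := hC.measurable_pushInformed v₀ t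
  have hY : Measurable fun ω v => C t v ω := measurable_pi_lambda _ (hC.measurable t)
  have := Measure.isProbabilityMeasure_map (μ := μ) hX.aemeasurable
  have := Measure.isProbabilityMeasure_map (μ := μ) hY.aemeasurable
  have hind := (indepFun_iff_map_prod_eq_prod_map_map hX.aemeasurable hY.aemeasurable).1
    (hC.indepFun_pushInformed v₀ t)
  let F : Finset (Fin n) × (Fin n → Fin n) → ℝ := fun q => f (pushStep q.1 q.2)
  calc ∫ ω, f (pushInformed (fun t v => C t v ω) v₀ (t + 1)) ∂μ
      = ∫ q, F q ∂(μ.map fun ω =>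
          (pushInformed (fun t v => C t v ω) v₀ t, fun v => C t v ω)) := by
        rw [integral_map (hX.prodMk hY).aemeasurable
          (Measurable.of_discrete (f := F)).aestronglyMeasurable]
        rfl
    _ = ∫ S, ∫ c, F (S, c) ∂(μ.map fun ω v => C t v ω)
          ∂(μ.map fun ω => pushInformed (fun t v => C t v ω) v₀ t) := by
        rw [hind, integral_prod _ .of_finite]
    _ = ∫ S, (𝔼 c, f (pushStep S c)) ∂(μ.map fun ω => pushInformed (fun t v => C t v ω) v₀ t) := by
        simp only [hC.integral_calls, F]
    _ = _ := integral_map hX.aemeasurable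
        (Measurable.of_discrete (f := fun S => 𝔼 c, f (pushStep S c))).aestronglyMeasurable

/-- The probability that some node is uninformed at the end of round `t`. -/
lemma integral_ite_ne_univ (hC : IsUniformCalls μ C) (v₀ : Fin n) (t : ℕ) :
    ∫ ω, (if pushInformed (fun t v => C t v ω) v₀ t ≠ Finset.univ then (1 : ℝ) else 0) ∂μ =
      μ.real {ω | pushInformed (fun t v => C t v ω) v₀ t ≠ Finset.univ} := by
  let _ : MeasurableSpace (Finset (Fin n)) := ⊤
  have hm : MeasurableSet {ω | pushInformed (fun t v => C t v ω) v₀ t ≠ Finset.univ} :=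
    hC.measurable_pushInformed v₀ t (MeasurableSet.of_discrete (s := {S | S ≠ Finset.univ}))
  rw [← integral_indicator_one hm]
  simp [Set.indicator_apply]

/-- A drift bound for a potential, summed over the rounds. -/
lemma integral_potential_le [IsProbabilityMeasure μ] (hC : IsUniformCalls μ C) (v₀ : Fin n)
    {f : Finset (Fin n) → ℝ} {a : ℝ}
    (hf : ∀ S, v₀ ∈ S → S ≠ Finset.univ → 𝔼 c, f (pushStep S c) ≤ f S + a) (N : ℕ) :
    ∫ ω, f (pushInformed (fun t v => C t v ω) v₀ N) ∂μ ≤ f {v₀} + a * ∑ t ∈ Finset.range N,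
      μ.real {ω | pushInformed (fun t v => C t v ω) v₀ t ≠ Finset.univ} := by
  have : Nonempty (Fin n) := ⟨v₀⟩
  have hf' : ∀ S, v₀ ∈ S → 𝔼 c, f (pushStep S c) ≤
      f S + a * if S ≠ Finset.univ then (1 : ℝ) else 0 := by
    intro S hS
    -- The full set is absorbing, so the potential does not change there and no drift is charged.
    by_cases h : S = Finset.univ
    · have hu (c : Fin n → Fin n) : pushStep Finset.univ c = Finset.univ :=
        Finset.univ_subset_iff.1 Finset.subset_union_left
      simp only [h, hu, Fintype.expect_const]
      simp
    · simpa [h] using hf S hS h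
  induction N with
  | zero => simp [pushInformed]
  | succ N ih =>
    rw [hC.integral_pushInformed_succ, Finset.sum_range_succ, mul_add, ← add_assoc]
    refine le_trans ?_ (add_le_add_left ih _)
    rw [← hC.integral_ite_ne_univ, ← integral_const_mul, ← integral_add]
    · refine integral_mono (hC.integrable_pushInformed v₀ N fun S => 𝔼 c, f (pushStep S c))
        (hC.integrable_pushInformed v₀ N fun S => f S + a * if S ≠ Finset.univ then (1 : ℝ) else 0)
        fun ω => hf' _ (mem_pushInformed _ _ _)
    · exact hC.integrable_pushInformed v₀ N f
    · exact hC.integrable_pushInformed v₀ N fun S => a * if S ≠ Finset.univ then (1 : ℝ) else 0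

lemma expectedPushTime_eq_tsum (hC : IsUniformCalls μ C) (v₀ : Fin n) :
    expectedPushTime μ C v₀ =
      ∑' t, μ {ω | pushInformed (fun t v => C t v ω) v₀ t ≠ Finset.univ} := by
  let _ : MeasurableSpace (Finset (Fin n)) := ⊤
  have hm (t : ℕ) : MeasurableSet {ω | pushInformed (fun t v => C t v ω) v₀ t ≠ Finset.univ} :=
    hC.measurable_pushInformed v₀ t (MeasurableSet.of_discrete (s := {S | S ≠ Finset.univ}))
  simp only [expectedPushTime, pushSpreadingTime_eq_tsum]
  rw [lintegral_tsum]
  · refine tsum_congr fun t => ?_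
    rw [← lintegral_indicator_one (hm t)]
    simp [Set.indicator_apply]
  · intro t
    exact ((Measurable.of_discrete (f := fun S : Finset (Fin n) =>
      if S ≠ Finset.univ then (1 : ℝ≥0∞) else 0)).comp
        (hC.measurable_pushInformed v₀ t)).aemeasurable

end IsUniformCalls

/-! ### Drift of the push process and boundary values -/

lemma drift_pushStep {n : ℕ} {v₀ : Fin n} {S : Finset (Fin n)} (hv : v₀ ∈ S)
    (hS : S ≠ Finset.univ) :
    (𝔼 c, (mainPotential n (pushStep S c).card + errorPotential n (pushStep S c).card) ≤
      mainPotential n S.card + errorPotential n S.card + -1) ∧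
    𝔼 c, (errorPotential n (pushStep S c).card - mainPotential n (pushStep S c).card) ≤
      errorPotential n S.card - mainPotential n S.card + 1 := by
  have : Nonempty (Fin n) := ⟨v₀⟩
  have hk : 1 ≤ S.card := Finset.card_pos.2 ⟨v₀, hv⟩
  have hkn : S.card < n := by
    simpa using Finset.card_lt_card (Finset.ssubset_univ_iff.2 hS)
  obtain ⟨h1, h2, h3⟩ := drift_bounds (K := fun c : Fin n → Fin n => ((pushStep S c).card : ℝ))
    hk hkn (fun c => by exact_mod_cast Finset.card_le_card Finset.subset_union_left)
    (fun c => by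
      have := (Finset.card_union_le S (S.image c)).trans
        (Nat.add_le_add_left Finset.card_image_le _)
      rw [← two_mul] at this
      exact_mod_cast this)
    (fun c => by exact_mod_cast (Finset.card_le_univ (pushStep S c)).trans_eq (Fintype.card_fin n))
    (expect_card_compl_pushStep (by omega) S) (variance_card_compl_pushStep_le (by omega) S)
  rw [Finset.expect_add_distrib, Finset.expect_sub_distrib]
  constructor <;> linarith

lemma neg_le_errorPotential {n k : ℝ} (hk : 0 < k) (hkn : k ≤ n) : -64 ≤ errorPotential n k := by
  have h1 : 1 / √(1 + (n - k)) ≤ 1 := by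
    rw [div_le_one (Real.sqrt_pos.2 (by linarith)), Real.one_le_sqrt]
    linarith
  have h2 : 0 ≤ (n - k) / n := div_nonneg (by linarith) (by linarith)
  have h3 : 0 ≤ 1 / k := by positivity
  unfold errorPotential
  linarith

lemma errorPotential_one_le {n : ℝ} (hn : 1 ≤ n) : errorPotential n 1 ≤ 24 := by
  have h1 : 0 ≤ 1 / √(1 + (n - 1)) := by positivity
  have h2 : (n - 1) / n ≤ 1 := by rw [div_le_one (by linarith)]; linarith
  unfold errorPotential
  linarith

lemma mainPotential_one (n : ℝ) : mainPotential n 1 = Real.log n := by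
  simp [mainPotential]

lemma neg_logb_le_mainPotential {n k : ℝ} (hk : 0 < k) (hkn : k ≤ n) :
    -Real.logb 2 n ≤ mainPotential n k := by
  have h1 : 0 ≤ Real.log (1 + (n - k)) := Real.log_nonneg (by linarith)
  have h2 : Real.logb 2 k ≤ Real.logb 2 n := Real.logb_le_logb_of_le (by norm_num) hk hkn
  unfold mainPotential
  linarith

lemma mainPotential_le_log {n k : ℝ} (hk : 1 ≤ k) (hkn : k ≤ n) :
    mainPotential n k ≤ Real.log n := by
  have h1 : Real.log (1 + (n - k)) ≤ Real.log n := Real.log_le_log (by linarith) (by linarith)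
  have h2 : 0 ≤ Real.logb 2 k := Real.logb_nonneg (by norm_num) hk
  unfold mainPotential
  linarith

lemma mainPotential_self (n : ℝ) : mainPotential n n = -Real.logb 2 n := by
  simp [mainPotential]

namespace IsUniformCalls

variable {Ω : Type*} [MeasurableSpace Ω] {μ : Measure Ω} [IsProbabilityMeasure μ] {n : ℕ}
  {C : ℕ → Fin n → Ω → Fin n}

/-- The sum of the potentials starts at most at ln n + 24 and never falls below -log₂ n - 64; 88 =
24 + 64. -/
lemma sum_prob_ne_univ_le (hC : IsUniformCalls μ C) (v₀ : Fin n) (N : ℕ) :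
    ∑ t ∈ Finset.range N, μ.real {ω | pushInformed (fun t v => C t v ω) v₀ t ≠ Finset.univ} ≤
      Real.logb 2 n + Real.log n + 88 := by
  have hn : (1 : ℝ) ≤ n := by exact_mod_cast v₀.pos
  have h := hC.integral_potential_le v₀
    (f := fun S => mainPotential n S.card + errorPotential n S.card)
    (fun S hv hS => (drift_pushStep hv hS).1) N
  have h2 : ∫ _, (-Real.logb 2 n - 64) ∂μ ≤ ∫ ω,
      (mainPotential n (pushInformed (fun t v => C t v ω) v₀ N).card +
        errorPotential n (pushInformed (fun t v => C t v ω) v₀ N).card) ∂μ := by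
    refine integral_mono (integrable_const _) (hC.integrable_pushInformed v₀ N fun S =>
      mainPotential n S.card + errorPotential n S.card) fun ω => ?_
    have hk : (0 : ℝ) < (pushInformed (fun t v => C t v ω) v₀ N).card := by
      exact_mod_cast Finset.card_pos.2 ⟨v₀, mem_pushInformed _ v₀ N⟩
    have hkn : ((pushInformed (fun t v => C t v ω) v₀ N).card : ℝ) ≤ n := by
      exact_mod_cast (Finset.card_le_univ _).trans_eq (Fintype.card_fin n)
    have h3 := neg_le_errorPotential hk hkn
    have h4 := neg_logb_le_mainPotential hk hkn
    simp only
    linarith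
  simp only [integral_const, probReal_univ, one_smul] at h2
  simp only [Finset.card_singleton, Nat.cast_one, mainPotential_one] at h
  have := errorPotential_one_le hn
  linarith

/-- If some node is still uninformed after N rounds, -`mainPotential` is only known to be at least
-ln n instead of log₂ n. The correction term pays for this gap of ln n + log₂ n. -/
lemma le_sum_prob_ne_univ (hC : IsUniformCalls μ C) (v₀ : Fin n) (N : ℕ) :
    Real.logb 2 n + Real.log n - 88 - (Real.log n + Real.logb 2 n) *
      μ.real {ω | pushInformed (fun t v => C t v ω) v₀ N ≠ Finset.univ} ≤
    ∑ t ∈ Finset.range N, μ.real {ω | pushInformed (fun t v => C t v ω) v₀ t ≠ Finset.univ} := by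
  have hn : (1 : ℝ) ≤ n := by exact_mod_cast v₀.pos
  have h := hC.integral_potential_le v₀
    (f := fun S => errorPotential n S.card - mainPotential n S.card)
    (fun S hv hS => (drift_pushStep hv hS).2) N
  have h2 : ∫ ω, ((Real.logb 2 n - 64) + -(Real.log n + Real.logb 2 n) *
        if pushInformed (fun t v => C t v ω) v₀ N ≠ Finset.univ then (1 : ℝ) else 0) ∂μ ≤ ∫ ω,
      (errorPotential n (pushInformed (fun t v => C t v ω) v₀ N).card -
        mainPotential n (pushInformed (fun t v => C t v ω) v₀ N).card) ∂μ := by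
    refine integral_mono (hC.integrable_pushInformed v₀ N fun S => (Real.logb 2 n - 64) +
        -(Real.log n + Real.logb 2 n) * if S ≠ Finset.univ then (1 : ℝ) else 0)
      (hC.integrable_pushInformed v₀ N fun S =>
        errorPotential n S.card - mainPotential n S.card) fun ω => ?_
    have hk : (1 : ℝ) ≤ (pushInformed (fun t v => C t v ω) v₀ N).card := by
      exact_mod_cast Finset.card_pos.2 ⟨v₀, mem_pushInformed _ v₀ N⟩
    have hkn : ((pushInformed (fun t v => C t v ω) v₀ N).card : ℝ) ≤ n := by
      exact_mod_cast (Finset.card_le_univ _).trans_eq (Fintype.card_fin n)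
    have h3 := neg_le_errorPotential (by linarith) hkn
    by_cases hu : pushInformed (fun t v => C t v ω) v₀ N = Finset.univ
    · simp only [hu, Finset.card_univ, Fintype.card_fin, mainPotential_self] at h3 ⊢
      simp only [ne_eq, not_true_eq_false, if_false]
      linarith
    · have h4 := mainPotential_le_log hk hkn
      simp only [ne_eq, hu, not_false_eq_true, if_true]
      linarith
  rw [integral_add (integrable_const _) (hC.integrable_pushInformed v₀ N fun S =>
      -(Real.log n + Real.logb 2 n) * if S ≠ Finset.univ then (1 : ℝ) else 0),
    integral_const_mul, hC.integral_ite_ne_univ] at h2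
  simp only [integral_const, probReal_univ, one_smul] at h2
  simp only [Finset.card_singleton, Nat.cast_one, mainPotential_one] at h
  have := errorPotential_one_le hn
  linarith

end IsUniformCalls

/-! ### Passage to the limit -/

theorem mainTheorem5 :
    ∃ K : ℝ, ∀ (n : ℕ) (v₀ : Fin n)
      (Ω : Type*) [MeasurableSpace Ω] (μ : Measure Ω) [IsProbabilityMeasure μ]
      (C : ℕ → Fin n → Ω → Fin n), IsUniformCalls μ C →
        expectedPushTime μ C v₀ ≠ ∞ ∧
        |(expectedPushTime μ C v₀).toReal - (Real.logb 2 n + Real.log n)| ≤ K := by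
  refine ⟨88, fun n v₀ Ω _ μ _ C hC => ?_⟩
  have hle := hC.sum_prob_ne_univ_le v₀
  have hge := hC.le_sum_prob_ne_univ v₀
  have hsum : Summable fun t =>
      μ.real {ω | pushInformed (fun t v => C t v ω) v₀ t ≠ Finset.univ} :=
    summable_of_sum_range_le (fun _ => measureReal_nonneg) hle
  have heq : expectedPushTime μ C v₀ = ENNReal.ofReal
      (∑' t, μ.real {ω | pushInformed (fun t v => C t v ω) v₀ t ≠ Finset.univ}) := by
    rw [hC.expectedPushTime_eq_tsum, ENNReal.ofReal_tsum_of_nonneg (fun _ => measureReal_nonneg) hsum]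
    exact tsum_congr fun t => (ofReal_measureReal (measure_ne_top _ _)).symm
  rw [heq]
  refine ⟨ENNReal.ofReal_ne_top, ?_⟩
  rw [ENNReal.toReal_ofReal (tsum_nonneg fun _ => measureReal_nonneg), abs_le]
  have hupper := le_of_tendsto' hsum.hasSum.tendsto_sum_nat hle
  -- The upper bound already makes the series summable, so its terms tend to 0 and the correction
  -- for unfinished runs disappears in the limit.
  have hlower := le_of_tendsto_of_tendsto'
    ((hsum.tendsto_atTop_zero.const_mul (Real.log n + Real.logb 2 n)).const_sub
      (Real.logb 2 n + Real.log n - 88)) hsum.hasSum.tendsto_sum_nat hge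
  rw [mul_zero, sub_zero] at hlower
  constructor <;> linarith
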